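/- A simplicial complex over a finite set $\Omega$ is a nonempty family $\Delta$ of subsets of $\Omega$ such that $\sigma\subseteq\tau\in\Delta$ implies $\sigma\in\Delta$; its $f$-polynomial is $f^\Delta(t)=\sum_{i\ge 0} f_{i-1}^\Delta\, t^i$, where $f_{i-1}^\Delta$ is the number of $\sigma\in\Delta$ with $\#\sigma=i$. For integers $d\ge 1$ and $k\ge 0$ let - $A_{d,k}$ be the number of permutations of $\{1,\dots,d\}$ with exactly $k$ descents (indices $1\le i<d$ with $w(i)>w(i+1)$); - $S_{d,k}$ be the number of set partitions of $\{1,\dots,d\}$ with exactly $k+1$ blocks; - $D_{d,k}$ be the number of derangements (permutations without fixed points) of $\{1,\dots,d+1\}$ with exactly $k+1$ exceedances (indices $i$ with $w(i)>i$). Then for every $d\ge 1$ each of the following three polynomials is the $f$-polynomial of some simplicial complex: the Eulerian polynomial $\sum_{k=0}^{d-1}A_{d,k}t^k$, the Stirling polynomial of the second kind $\sum_{k=0}^{d-1}S_{d,k}t^k$, and the derangement polynomial $\sum_{k=0}^{d-1}D_{d,k}t^k$ (which equals $t^{-1}\sum_w t^{\mathrm{exc}(w)}$, the sum being over all derangements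 $w$ of $\{1,\dots,d+1\}$ and $\mathrm{exc}(w)$ being the number of exceedances of $w$). -/

import Mathlib

open Polynomial

/-- `Δ` is a simplicial complex over the ground set `Ω`: a nonempty (finite) family of finite
subsets of `Ω` that contains every subset of each of its members. -/
def IsSimplicialComplex {Ω : Type} (Δ : Finset (Finset Ω)) : Prop :=
  Δ.Nonempty ∧ ∀ σ τ : Finset Ω, σ ⊆ τ → τ ∈ Δ → σ ∈ Δ

/-- The number of faces of `Δ` with `i` elements, i.e. of dimension `i - 1`. -/
def faceNumber {Ω : Type} (Δ : Finset (Finset Ω)) (i : ℕ) : ℕ :=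
  (Δ.filter fun σ => σ.card = i).card

/-- The `f`-polynomial `∑ i, f_{i-1} t ^ i`, where `i` runs from `0` to the largest
cardinality of a face, which is the dimension of `Δ` plus one. -/
noncomputable def fPolynomial {Ω : Type} (Δ : Finset (Finset Ω)) : ℤ[X] :=
  ∑ i ∈ Finset.range (Δ.sup Finset.card + 1), C (faceNumber Δ i : ℤ) * X ^ i

/-- `p` is the `f`-polynomial of a simplicial complex over some finite ground set. -/
def IsFPolynomial (p : ℤ[X]) : Prop :=
  ∃ (Ω : Type) (_ : Finite Ω) (Δ : Finset (Finset Ω)),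
    IsSimplicialComplex Δ ∧ fPolynomial Δ = p

/-- The number of descents of a permutation `w` of `Fin d`: positions `i` such that `i + 1` is
also a position and `w (i + 1) < w i`. -/
def descentCount {d : ℕ} (w : Equiv.Perm (Fin d)) : ℕ :=
  (Finset.univ.filter fun i : Fin d => ∃ h : i.val + 1 < d, w ⟨i.val + 1, h⟩ < w i).card

/-- The number of exceedances of a permutation `w` of `Fin d`: positions `i` with `i < w i`. -/
def exceedanceCount {d : ℕ} (w : Equiv.Perm (Fin d)) : ℕ :=
  (Finset.univ.filter fun i : Fin d => i < w i).card

/-- The number of permutations of a `d`-element chain with `k` descents. -/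
noncomputable def eulerianNumber (d k : ℕ) : ℕ :=
  Nat.card {w : Equiv.Perm (Fin d) // descentCount w = k}

/-- The number of set partitions of a `d`-element set into `k + 1` blocks. -/
noncomputable def stirlingNumber (d k : ℕ) : ℕ :=
  Nat.card {P : Finpartition (Finset.univ : Finset (Fin d)) // P.parts.card = k + 1}

/-- The number of derangements of a `(d + 1)`-element chain with `k + 1` exceedances. -/
noncomputable def derangementNumber (d k : ℕ) : ℕ :=
  Nat.card {w : Equiv.Perm (Fin (d + 1)) // w ∈ derangements (Fin (d + 1)) ∧
    exceedanceCount w = k + 1}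

/-- The `d`-th row polynomial `∑ k, T d k * t ^ k` of a triangular array whose row `d` is
supported in `0 ≤ k ≤ d - 1`. -/
noncomputable def rowPolynomial (T : ℕ → ℕ → ℕ) (d : ℕ) : ℤ[X] :=
  ∑ k ∈ Finset.range d, C (T d k : ℤ) * X ^ k

/-- The `d`-th Eulerian polynomial. -/
noncomputable def eulerianPolynomial (d : ℕ) : ℤ[X] := rowPolynomial eulerianNumber d

/-- The `d`-th Stirling polynomial of the second kind. -/
noncomputable def stirlingPolynomial (d : ℕ) : ℤ[X] := rowPolynomial stirlingNumber d

/-- The `d`-th derangement polynomial, `t⁻¹ * ∑ w, t ^ exc w` over the derangements `w` of a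
`(d + 1)`-element chain. -/
noncomputable def derangementPolynomial (d : ℕ) : ℤ[X] := rowPolynomial derangementNumber d

/-! The Stirling case is direct. A partition of `Fin (n + 1)` is determined by its blocks not
containing `0`, and families of disjoint nonempty sets avoiding `0` are closed under subfamilies, so
they form a complex whose faces with `k` elements match the partitions with `k + 1` blocks.

The Eulerian and derangement cases read a recurrence as a construction. Both have rows with the same
constant term and `h (k + 1) = (k + 2) * f (k + 1) + (m + 1 - k) * f k + e * g k`, where `h`, `f`,
`g` are successive rows; `e = 0` in the Eulerian case. Suppose `f` is the face vector of a complex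
properly coloured by `m` colours, and `g` that of a subfamily closed under subsets. Attach pairwise
nonadjacent new vertices, each coned over a lower family of faces: - a twin of each vertex, over the
link of that vertex, which adds `(k + 1) * f (k + 1)` faces with `k + 1` elements; - one vertex for
each of `m + 1` colours, over the faces missing that colour, which adds `(m + 1 - k) * f k`; - `e`
vertices over the subfamily, which add `e * g k`.

With the old faces this gives `h`, and the new complex is coloured by `m + 1` colours and contains
the old one, so the construction iterates (`IsBalancedFacePair.step`). The colouring makes the
coefficient `m + 1 - k` exact and bounds the dimension. The recurrences
(`eulerianNumber_add_two_succ`, `derangementExceedances_add_two_succ`) come from inserting the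
largest element into a permutation, in a position of the word or in a cycle. -/

/-! ### Balanced complexes and the attachment of new vertices. -/

section Complexes

variable {Ω N : Type}

/-- The faces of `Δ`, together with the cones `σ ∪ {x}` over the faces `σ` of `L x`. -/
def attachVertices [Fintype N] [DecidableEq Ω] [DecidableEq N]
    (Δ : Finset (Finset Ω)) (L : N → Finset (Finset Ω)) : Finset (Finset (Ω ⊕ N)) :=
  Δ.image (fun σ => σ.disjSum ∅) ∪
    (Finset.univ.sigma L).image fun p => p.2.disjSum {p.1}

theorem mem_attachVertices [Fintype N] [DecidableEq Ω] [DecidableEq N]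
    {Δ : Finset (Finset Ω)} {L : N → Finset (Finset Ω)} {τ : Finset (Ω ⊕ N)} :
    τ ∈ attachVertices Δ L ↔
      (∃ σ ∈ Δ, σ.disjSum ∅ = τ) ∨ ∃ x, ∃ σ ∈ L x, σ.disjSum {x} = τ := by
  simp [attachVertices]

theorem isLowerSet_attachVertices [Fintype N] [DecidableEq Ω] [DecidableEq N]
    {Δ : Finset (Finset Ω)} {L : N → Finset (Finset Ω)}
    (hΔ : IsLowerSet (Δ : Set (Finset Ω))) (hL : ∀ x, IsLowerSet (L x : Set (Finset Ω)))
    (hLΔ : ∀ x, L x ⊆ Δ) : IsLowerSet (attachVertices Δ L : Set (Finset (Ω ⊕ N))) := by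
  intro τ ρ hρ hτ
  simp only [Finset.mem_coe, mem_attachVertices] at hτ ⊢
  have hsub : ∀ (σ : Finset Ω) (t : Finset N), σ.disjSum t = τ →
      ρ.toLeft ⊆ σ ∧ ρ.toRight ⊆ t := by
    rintro σ t rfl
    refine ⟨fun a ha => ?_, fun a ha => ?_⟩
    · simpa using hρ (Finset.mem_toLeft.1 ha)
    · simpa using hρ (Finset.mem_toRight.1 ha)
  have hdec : ρ.toLeft.disjSum ρ.toRight = ρ := Finset.toLeft_disjSum_toRight
  rcases hτ with ⟨σ, hσ, h⟩ | ⟨x, σ, hσ, h⟩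
  · obtain ⟨h1, h2⟩ := hsub _ _ h
    refine Or.inl ⟨ρ.toLeft, hΔ h1 hσ, ?_⟩
    rw [← Finset.subset_empty.1 h2, hdec]
  · obtain ⟨h1, h2⟩ := hsub _ _ h
    rcases Finset.subset_singleton_iff.1 h2 with h3 | h3
    · exact Or.inl ⟨ρ.toLeft, hΔ h1 (hLΔ x hσ), by rw [← h3, hdec]⟩
    · exact Or.inr ⟨x, ρ.toLeft, hL x h1 hσ, by rw [← h3, hdec]⟩

theorem disjSum_inj {s s' : Finset Ω} {t t' : Finset N} (h : s.disjSum t = s'.disjSum t') :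
    s = s' ∧ t = t' :=
  ⟨by simpa using congrArg Finset.toLeft h, by simpa using congrArg Finset.toRight h⟩

theorem faceNumber_image_disjSum_empty [DecidableEq Ω] [DecidableEq N] (Δ : Finset (Finset Ω))
    (k : ℕ) :
    faceNumber (Δ.image fun σ => σ.disjSum (∅ : Finset N)) k = faceNumber Δ k := by
  unfold faceNumber
  rw [Finset.filter_image, Finset.card_image_of_injective]
  · simp
  · intro a b h
    exact (disjSum_inj h).1

theorem faceNumber_attachVertices_zero [Fintype N] [DecidableEq Ω] [DecidableEq N]
    (Δ : Finset (Finset Ω)) (L : N → Finset (Finset Ω)) :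
    faceNumber (attachVertices Δ L) 0 = faceNumber Δ 0 := by
  rw [← faceNumber_image_disjSum_empty (N := N) Δ, faceNumber, faceNumber, attachVertices,
    Finset.filter_union, Finset.filter_image (s := Finset.univ.sigma L)]
  simp

theorem faceNumber_attachVertices_succ [Fintype N] [DecidableEq Ω] [DecidableEq N]
    (Δ : Finset (Finset Ω)) (L : N → Finset (Finset Ω)) (k : ℕ) :
    faceNumber (attachVertices Δ L) (k + 1) =
      faceNumber Δ (k + 1) + ∑ x, faceNumber (L x) k := by
  rw [← faceNumber_image_disjSum_empty (N := N) Δ, faceNumber, faceNumber, attachVertices,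
    Finset.filter_union, Finset.card_union_of_disjoint]
  · congr 1
    rw [Finset.filter_image, Finset.card_image_of_injective]
    · simp only [faceNumber, Finset.card_disjSum, Finset.card_singleton, add_left_inj]
      rw [← Finset.card_sigma]
      congr 1
      ext ⟨x, σ⟩
      simp
    · rintro ⟨x, σ⟩ ⟨y, τ⟩ h
      obtain ⟨h1, h2⟩ := disjSum_inj h
      obtain rfl : x = y := by simpa using h2
      obtain rfl : σ = τ := h1
      rfl
  · rw [Finset.disjoint_left]
    intro τ h1 h2
    simp only [Finset.mem_filter, Finset.mem_image] at h1 h2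
    obtain ⟨⟨σ, -, rfl⟩, -⟩ := h1
    obtain ⟨⟨p, -, hp⟩, -⟩ := h2
    simpa using (disjSum_inj hp).2

/-- The link of the vertex `a` in `Δ`. -/
def vertexLink [DecidableEq Ω] (Δ : Finset (Finset Ω)) (a : Ω) : Finset (Finset Ω) :=
  Δ.filter fun σ => a ∉ σ ∧ insert a σ ∈ Δ

theorem isLowerSet_vertexLink [DecidableEq Ω] {Δ : Finset (Finset Ω)}
    (hΔ : IsLowerSet (Δ : Set (Finset Ω))) (a : Ω) :
    IsLowerSet (vertexLink Δ a : Set (Finset Ω)) := by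
  intro τ ρ hρ hτ
  simp only [vertexLink, Finset.coe_filter, Set.mem_ofPred_eq] at hτ ⊢
  exact ⟨hΔ hρ hτ.1, fun h => hτ.2.1 (hρ h), hΔ (Finset.insert_subset_insert a hρ) hτ.2.2⟩

/-- Double count the pairs of a face with `k + 1` elements and a point in it. -/
theorem sum_faceNumber_vertexLink [Fintype Ω] [DecidableEq Ω] {Δ : Finset (Finset Ω)}
    (hΔ : IsLowerSet (Δ : Set (Finset Ω))) (k : ℕ) :
    ∑ a, faceNumber (vertexLink Δ a) k = (k + 1) * faceNumber Δ (k + 1) := by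
  have h : ∀ a, faceNumber (vertexLink Δ a) k =
      ∑ τ ∈ Δ.filter (fun σ => σ.card = k + 1), if a ∈ τ then 1 else 0 := by
    intro a
    rw [← Finset.card_filter, faceNumber]
    refine Finset.card_nbij' (fun σ => insert a σ) (fun τ => τ.erase a) ?_ ?_ ?_ ?_
    · intro σ hσ
      simp only [vertexLink, Finset.coe_filter, Finset.mem_filter, Set.mem_ofPred_eq] at hσ ⊢
      simp [hσ.1.2.2, Finset.card_insert_of_notMem hσ.1.2.1, hσ.2]
    · intro τ hτ
      simp only [vertexLink, Finset.coe_filter, Finset.mem_filter, Set.mem_ofPred_eq] at hτ ⊢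
      refine ⟨⟨hΔ (Finset.erase_subset a τ) hτ.1.1, Finset.notMem_erase a τ, ?_⟩, ?_⟩
      · rw [Finset.insert_erase hτ.2]; exact hτ.1.1
      · rw [Finset.card_erase_of_mem hτ.2, hτ.1.2]; rfl
    · intro σ hσ
      simp only [vertexLink, Finset.coe_filter, Finset.mem_filter, Set.mem_ofPred_eq] at hσ
      exact Finset.erase_insert hσ.1.2.1
    · intro τ hτ
      simp only [Finset.coe_filter, Finset.mem_filter, Set.mem_ofPred_eq] at hτ
      exact Finset.insert_erase hτ.2
  simp only [h]
  rw [Finset.sum_comm, faceNumber, mul_comm, ← smul_eq_mul, ← Finset.sum_const]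
  refine Finset.sum_congr rfl fun τ hτ => ?_
  rw [← Finset.card_filter, Finset.filter_univ_mem, (Finset.mem_filter.1 hτ).2]

/-- The faces of `Δ` without a vertex of colour `i`. -/
def avoidColour (Δ : Finset (Finset Ω)) (c : Ω → ℕ) (i : ℕ) : Finset (Finset Ω) :=
  Δ.filter fun σ => i ∉ σ.image c

theorem isLowerSet_avoidColour {Δ : Finset (Finset Ω)}
    (hΔ : IsLowerSet (Δ : Set (Finset Ω))) (c : Ω → ℕ) (i : ℕ) :
    IsLowerSet (avoidColour Δ c i : Set (Finset Ω)) := by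
  intro τ ρ hρ hτ
  simp only [avoidColour, Finset.coe_filter, Set.mem_ofPred_eq] at hτ ⊢
  exact ⟨hΔ hρ hτ.1, fun h => hτ.2 (Finset.image_subset_image hρ h)⟩

/-- `c` properly colours the faces of `Δ` with colours below `m`. -/
def IsBalancedColouring (Δ : Finset (Finset Ω)) (c : Ω → ℕ) (m : ℕ) : Prop :=
  ∀ σ ∈ Δ, Set.InjOn c σ ∧ ∀ x ∈ σ, c x < m

/-- Double count the pairs of a face and a colour it misses: a face with `k` elements uses exactly
`k` of the colours `0, ..., m`. Colour `m` occurs in no face, so its term counts all of `Δ`. -/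
theorem sum_faceNumber_avoidColour {Δ : Finset (Finset Ω)} {c : Ω → ℕ} {m : ℕ}
    (hc : IsBalancedColouring Δ c m) (k : ℕ) :
    ∑ i : Fin (m + 1), faceNumber (avoidColour Δ c i) k = (m + 1 - k) * faceNumber Δ k := by
  rw [Fin.sum_univ_eq_sum_range (fun i => faceNumber (avoidColour Δ c i) k)]
  simp only [faceNumber, avoidColour]
  have h : ∀ i, ((Δ.filter fun σ => i ∉ σ.image c).filter fun σ => σ.card = k).card =
      ∑ τ ∈ Δ.filter (fun σ => σ.card = k), if i ∉ τ.image c then 1 else 0 := by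
    intro i
    rw [← Finset.card_filter, Finset.filter_comm]
  simp only [h]
  rw [Finset.sum_comm, mul_comm, ← smul_eq_mul, ← Finset.sum_const]
  refine Finset.sum_congr rfl fun τ hτ => ?_
  obtain ⟨hτ1, hτ2⟩ := Finset.mem_filter.1 hτ
  obtain ⟨hinj, hlt⟩ := hc τ hτ1
  rw [← Finset.card_filter, Finset.filter_notMem_eq_sdiff, Finset.card_sdiff_of_subset,
    Finset.card_range, Finset.card_image_of_injOn hinj, hτ2]
  intro i hi
  obtain ⟨x, hx, rfl⟩ := Finset.mem_image.1 hi
  exact Finset.mem_range.2 (Nat.lt_succ_of_lt (hlt x hx))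

/-- The bound on `b x` is needed only for nonempty `L x`, since otherwise `x` lies in no face. This
covers the twins of points of `Ω` that are not vertices of `Δ`. -/
theorem isBalancedColouring_attachVertices [Fintype N] [DecidableEq Ω] [DecidableEq N]
    {Δ : Finset (Finset Ω)} {L : N → Finset (Finset Ω)} {c : Ω → ℕ} {m : ℕ}
    (hc : IsBalancedColouring Δ c m) (hLΔ : ∀ x, L x ⊆ Δ) {b : N → ℕ}
    (hb : ∀ x, (L x).Nonempty → b x < m + 1) (hbL : ∀ x, ∀ σ ∈ L x, ∀ y ∈ σ, c y ≠ b x) :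
    IsBalancedColouring (attachVertices Δ L) (Sum.elim c b) (m + 1) := by
  intro τ hτ
  rcases mem_attachVertices.1 hτ with ⟨σ, hσ, rfl⟩ | ⟨x, σ, hσ, rfl⟩
  · obtain ⟨h1, h2⟩ := hc σ hσ
    refine ⟨?_, ?_⟩
    · rintro (y | y) hy (z | z) hz h <;> simp_all
      exact h1 hy hz h
    · rintro (y | y) hy <;> simp_all
      exact (h2 y hy).le
  · obtain ⟨h1, h2⟩ := hc σ (hLΔ x hσ)
    refine ⟨?_, ?_⟩
    · rintro (y | y) hy (z | z) hz h <;> simp only [Finset.mem_coe, Finset.inl_mem_disjSum,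
        Finset.inr_mem_disjSum, Finset.mem_singleton, Sum.elim_inl, Sum.elim_inr] at hy hz h
      · rw [h1 hy hz h]
      · subst hz; exact absurd h (hbL _ _ hσ _ hy)
      · subst hy; exact absurd h.symm (hbL _ _ hσ _ hz)
      · rw [hy, hz]
    · rintro (y | y) hy <;> simp only [Finset.inl_mem_disjSum,
        Finset.inr_mem_disjSum, Finset.mem_singleton, Sum.elim_inl, Sum.elim_inr] at hy ⊢
      · exact Nat.lt_succ_of_lt (h2 y hy)
      · subst hy; exact hb _ ⟨σ, hσ⟩

/-- `f` is the face vector of a simplicial complex that is properly coloured by `m` colours, and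
`g` is the face vector of a (possibly empty) lower family of its faces. -/
def IsBalancedFacePair (f g : ℕ → ℕ) (m : ℕ) : Prop :=
  ∃ (Ω : Type) (_ : Fintype Ω) (Δ Δ' : Finset (Finset Ω)) (c : Ω → ℕ),
    Δ.Nonempty ∧ IsLowerSet (Δ : Set (Finset Ω)) ∧ IsLowerSet (Δ' : Set (Finset Ω)) ∧ Δ' ⊆ Δ ∧
    IsBalancedColouring Δ c m ∧ (∀ k, faceNumber Δ k = f k) ∧ ∀ k, faceNumber Δ' k = g k

/-- The inductive step. The old complex becomes the distinguished subfamily of the new one, which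
keeps the previous row available for a three-term recurrence. -/
theorem IsBalancedFacePair.step {f g h : ℕ → ℕ} {m : ℕ} (hfg : IsBalancedFacePair f g m) (e : ℕ)
    (h_zero : h 0 = f 0)
    (h_succ : ∀ k, h (k + 1) = (k + 2) * f (k + 1) + (m + 1 - k) * f k + e * g k) :
    IsBalancedFacePair h f (m + 1) := by
  classical
  obtain ⟨Ω, _, Δ, Δ', c, hne, hΔ, hΔ', hsub, hc, hf, hg⟩ := hfg
  let L : Ω ⊕ (Fin (m + 1) ⊕ Fin e) → Finset (Finset Ω) :=
    Sum.elim (vertexLink Δ) (Sum.elim (fun i => avoidColour Δ c i) fun _ => Δ')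
  -- A twin keeps the colour of its original, a colour-avoiding cone takes the avoided colour, and
  -- the cones over `Δ'` take the fresh colour `m`.
  let b : Ω ⊕ (Fin (m + 1) ⊕ Fin e) → ℕ :=
    Sum.elim c (Sum.elim (fun i => i) fun _ => m)
  have hLΔ : ∀ x, L x ⊆ Δ := by
    rintro (a | i | j)
    · exact Finset.filter_subset _ _
    · exact Finset.filter_subset _ _
    · exact hsub
  have hL : ∀ x, IsLowerSet (L x : Set (Finset Ω)) := by
    rintro (a | i | j)
    · exact isLowerSet_vertexLink hΔ a
    · exact isLowerSet_avoidColour hΔ c i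
    · exact hΔ'
  refine ⟨_, inferInstance, attachVertices Δ L, Δ.image (fun σ => σ.disjSum ∅), Sum.elim c b,
    ?_, isLowerSet_attachVertices hΔ hL hLΔ, ?_, Finset.subset_union_left, ?_, ?_, ?_⟩
  · exact (hne.image _).mono Finset.subset_union_left
  -- The embedded copy of `Δ` is the attachment in which every new vertex has an empty family.
  · have := isLowerSet_attachVertices (N := Ω ⊕ (Fin (m + 1) ⊕ Fin e)) (L := fun _ => ∅) hΔ
      (fun _ => by simp [isLowerSet_empty]) (fun _ => Finset.empty_subset _)
    simpa [attachVertices] using this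
  · refine isBalancedColouring_attachVertices hc hLΔ ?_ ?_
    · rintro (a | i | j) ⟨σ, hσ⟩
      · simp only [L, b, Sum.elim_inl, vertexLink, Finset.mem_filter] at hσ ⊢
        exact Nat.lt_succ_of_lt ((hc _ hσ.2.2).2 a (Finset.mem_insert_self a σ))
      · exact i.2
      · exact Nat.lt_succ_self m
    · rintro (a | i | j) σ hσ y hy
      · simp only [L, b, Sum.elim_inl, vertexLink, Finset.mem_filter] at hσ ⊢
        intro hya
        have := (hc _ hσ.2.2).1 (by simp [hy]) (by simp) hya
        exact hσ.2.1 (this ▸ hy)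
      · simp only [L, b, Sum.elim_inl, Sum.elim_inr, avoidColour, Finset.mem_filter] at hσ ⊢
        intro h
        exact hσ.2 (h ▸ Finset.mem_image_of_mem c hy)
      · exact ((hc _ (hsub hσ)).2 y hy).ne
  · rintro (_ | k)
    · rw [faceNumber_attachVertices_zero, hf, h_zero]
    · rw [faceNumber_attachVertices_succ, h_succ, Fintype.sum_sum_type, Fintype.sum_sum_type]
      simp only [L, Sum.elim_inl, Sum.elim_inr]
      rw [sum_faceNumber_vertexLink hΔ, sum_faceNumber_avoidColour hc, hf, hf]
      simp only [hg, Finset.sum_const, Finset.card_univ, Fintype.card_fin, smul_eq_mul]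
      ring
  · intro k
    rw [faceNumber_image_disjSum_empty, hf]

theorem isBalancedFacePair_base {f g : ℕ → ℕ} (hf : f 0 = 1) (hf' : ∀ k, f (k + 1) = 0)
    (hg : ∀ k, g k = 0) : IsBalancedFacePair f g 0 := by
  refine ⟨Empty, inferInstance, {∅}, ∅, fun _ => 0, by simp, ?_, by simp [isLowerSet_empty],
    by simp, ?_, ?_, ?_⟩
  · intro a b hb ha
    simp [Finset.eq_empty_of_isEmpty b]
  · intro σ hσ
    simp [Finset.eq_empty_of_isEmpty σ]
  · rintro (_ | k)
    · simp [hf, faceNumber, Finset.filter_singleton]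
    · simp [hf', faceNumber, Finset.filter_singleton]
  · intro k
    simp [hg, faceNumber]

theorem coeff_fPolynomial (Δ : Finset (Finset Ω)) (k : ℕ) :
    (fPolynomial Δ).coeff k = faceNumber Δ k := by
  rw [fPolynomial, Polynomial.finsetSum_coeff]
  simp only [Polynomial.coeff_C_mul_X_pow]
  rw [Finset.sum_ite_eq]
  split_ifs with h
  · rfl
  · symm
    rw [Nat.cast_eq_zero, faceNumber, Finset.card_eq_zero, Finset.filter_eq_empty_iff]
    rintro σ hσ rfl
    exact h (Finset.mem_range.2 (Nat.lt_succ_of_le (Finset.le_sup (f := Finset.card) hσ)))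

theorem fPolynomial_eq_rowPolynomial {Δ : Finset (Finset Ω)} {T : ℕ → ℕ → ℕ} {d : ℕ}
    (h : ∀ k < d, faceNumber Δ k = T d k) (h' : ∀ σ ∈ Δ, σ.card < d) :
    fPolynomial Δ = rowPolynomial T d := by
  ext k
  rw [coeff_fPolynomial, rowPolynomial, Polynomial.finsetSum_coeff]
  simp only [Polynomial.coeff_C_mul_X_pow]
  rw [Finset.sum_ite_eq]
  split_ifs with hk
  · rw [h k (Finset.mem_range.1 hk)]
  · rw [Nat.cast_eq_zero, faceNumber, Finset.card_eq_zero, Finset.filter_eq_empty_iff]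
    rintro σ hσ rfl
    exact hk (Finset.mem_range.2 (h' σ hσ))

theorem IsBalancedFacePair.isFPolynomial {T : ℕ → ℕ → ℕ} {g : ℕ → ℕ} {d : ℕ}
    (h : IsBalancedFacePair (T (d + 1)) g d) : IsFPolynomial (rowPolynomial T (d + 1)) := by
  obtain ⟨Ω, _, Δ, Δ', c, hne, hΔ, -, -, hc, hf, -⟩ := h
  refine ⟨Ω, inferInstance, Δ, ⟨hne, fun σ τ h1 h2 => hΔ h1 h2⟩,
    fPolynomial_eq_rowPolynomial (fun k _ => hf k) fun σ hσ => ?_⟩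
  obtain ⟨hinj, hlt⟩ := hc σ hσ
  -- A face injects into the `d` colours, so no face is too large for the range of the row
  -- polynomial.
  have := Finset.card_le_card_of_injOn (t := Finset.range d) c
    (fun x hx => Finset.mem_range.2 (hlt x hx)) hinj
  rw [Finset.card_range] at this
  omega

end Complexes

/-! ### Set partitions as families of disjoint blocks. -/

section Stirling

open Classical in
/-- The families of disjoint nonempty subsets of `Fin (n + 1)` that do not contain `0`. -/
noncomputable def disjointFamilies (n : ℕ) : Finset (Finset (Finset (Fin (n + 1)))) :=
  Finset.univ.filter fun F =>
    (F : Set (Finset (Fin (n + 1)))).PairwiseDisjoint id ∧ ∀ s ∈ F, s.Nonempty ∧ 0 ∉ s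

theorem mem_disjointFamilies {n : ℕ} {F : Finset (Finset (Fin (n + 1)))} :
    F ∈ disjointFamilies n ↔
      (F : Set (Finset (Fin (n + 1)))).PairwiseDisjoint id ∧ ∀ s ∈ F, s.Nonempty ∧ 0 ∉ s := by
  simp [disjointFamilies]

theorem isSimplicialComplex_disjointFamilies (n : ℕ) :
    IsSimplicialComplex (disjointFamilies n) := by
  refine ⟨⟨∅, mem_disjointFamilies.2 (by simp)⟩, fun F G hFG hG => ?_⟩
  rw [mem_disjointFamilies] at hG ⊢
  exact ⟨hG.1.subset (Finset.coe_subset.2 hFG), fun s hs => hG.2 s (hFG hs)⟩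

theorem zero_notMem_sup_of_mem_disjointFamilies {n : ℕ} {F : Finset (Finset (Fin (n + 1)))}
    (hF : F ∈ disjointFamilies n) : (0 : Fin (n + 1)) ∉ F.sup id := by
  rw [Finset.mem_sup]
  rintro ⟨s, hs, h0⟩
  exact ((mem_disjointFamilies.1 hF).2 s hs).2 h0

/-- The partition of `Fin (n + 1)` into the members of a disjoint family and the block of the
remaining elements. -/
def partitionOfFamily {n : ℕ} (F : Finset (Finset (Fin (n + 1)))) (hF : F ∈ disjointFamilies n) :
    Finpartition (Finset.univ : Finset (Fin (n + 1))) where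
  parts := insert (F.sup id)ᶜ F
  supIndep := by
    rw [Finset.supIndep_iff_pairwiseDisjoint, Finset.coe_insert]
    refine (mem_disjointFamilies.1 hF).1.insert fun s hs _ => ?_
    exact disjoint_compl_left.mono_right (Finset.le_sup (f := id) hs)
  sup_parts := by
    rw [Finset.sup_insert]
    exact compl_sup_eq_top
  bot_notMem := by
    intro h
    rcases Finset.mem_insert.1 h with h | h
    · have := Finset.mem_compl.2 (zero_notMem_sup_of_mem_disjointFamilies hF)
      rw [← h] at this
      simp at this
    · simpa using ((mem_disjointFamilies.1 hF).2 _ h).1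

theorem compl_sup_notMem {n : ℕ} {F : Finset (Finset (Fin (n + 1)))}
    (hF : F ∈ disjointFamilies n) : (F.sup id)ᶜ ∉ F := fun h =>
  ((mem_disjointFamilies.1 hF).2 _ h).2
    (Finset.mem_compl.2 (zero_notMem_sup_of_mem_disjointFamilies hF))

theorem erase_part_mem_disjointFamilies {n : ℕ}
    (P : Finpartition (Finset.univ : Finset (Fin (n + 1)))) :
    P.parts.erase (P.part 0) ∈ disjointFamilies n := by
  refine mem_disjointFamilies.2 ⟨P.disjoint.subset (by simp), fun s hs => ?_⟩
  obtain ⟨h1, h2⟩ := Finset.mem_erase.1 hs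
  exact ⟨P.nonempty_of_mem_parts h2, fun h0 => h1 (P.part_eq_of_mem h2 h0).symm⟩

theorem compl_sup_erase_part {n : ℕ}
    (P : Finpartition (Finset.univ : Finset (Fin (n + 1)))) :
    ((P.parts.erase (P.part 0)).sup id)ᶜ = P.part 0 := by
  ext x
  simp only [Finset.mem_compl, Finset.mem_sup, Finset.mem_erase, id, not_exists, not_and]
  constructor
  · intro h
    obtain ⟨t, ht, hx⟩ := P.exists_mem (Finset.mem_univ x)
    by_contra hx0
    exact h t ⟨fun h' => hx0 (h' ▸ hx), ht⟩ hx
  · rintro hx s ⟨h1, h2⟩ hxs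
    exact h1 (P.eq_of_mem_parts h2 (P.part_mem.2 (Finset.mem_univ 0)) hxs hx)

/-- Forget the block of `0`; it is recovered as the complement of the union of the others. -/
theorem stirlingNumber_eq_faceNumber (n k : ℕ) :
    stirlingNumber (n + 1) k = faceNumber (disjointFamilies n) k := by
  rw [faceNumber, stirlingNumber, ← Nat.card_eq_finsetCard]
  refine Nat.card_congr
    { toFun := fun P => ⟨P.1.parts.erase (P.1.part 0), ?_⟩
      invFun := fun F => ⟨partitionOfFamily F.1 (Finset.mem_filter.1 F.2).1, ?_⟩
      left_inv := ?_
      right_inv := ?_ }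
  · refine Finset.mem_filter.2 ⟨erase_part_mem_disjointFamilies P.1, ?_⟩
    rw [Finset.card_erase_of_mem (P.1.part_mem.2 (Finset.mem_univ 0)), P.2]
    rfl
  · obtain ⟨h1, h2⟩ := Finset.mem_filter.1 F.2
    rw [partitionOfFamily, Finset.card_insert_of_notMem (compl_sup_notMem h1), h2]
  · rintro ⟨P, hP⟩
    refine Subtype.ext (Finpartition.ext ?_)
    simp only [partitionOfFamily]
    rw [compl_sup_erase_part, Finset.insert_erase (P.part_mem.2 (Finset.mem_univ 0))]
  · rintro ⟨F, hF⟩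
    have h1 := (Finset.mem_filter.1 hF).1
    refine Subtype.ext ?_
    have : (partitionOfFamily F h1).part 0 = (F.sup id)ᶜ :=
      Finpartition.part_eq_of_mem _ (Finset.mem_insert_self _ _)
        (Finset.mem_compl.2 (zero_notMem_sup_of_mem_disjointFamilies h1))
    simp only [this]
    exact Finset.erase_insert (compl_sup_notMem h1)

theorem isFPolynomial_stirlingPolynomial (n : ℕ) : IsFPolynomial (stirlingPolynomial (n + 1)) := by
  refine ⟨_, inferInstance, disjointFamilies n, isSimplicialComplex_disjointFamilies n,
    fPolynomial_eq_rowPolynomial (fun k _ => (stirlingNumber_eq_faceNumber n k).symm) ?_⟩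
  intro F hF
  have h := (partitionOfFamily F hF).card_parts_le_card
  rw [partitionOfFamily, Finset.card_insert_of_notMem (compl_sup_notMem hF), Finset.card_univ,
    Fintype.card_fin] at h
  exact h

end Stirling

/-! ### Counting insertions that keep or raise a statistic. -/

section Counting

variable {W Q : Type} [Fintype W] [Fintype Q]

theorem card_filter_prod_eq_sum (P : W → Q → Prop) [∀ w q, Decidable (P w q)] :
    (Finset.univ.filter fun x : W × Q => P x.1 x.2).card =
      ∑ w, (Finset.univ.filter fun q => P w q).card := by
  simp only [Finset.card_filter]
  exact Fintype.sum_prod_type _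

/-- If a statistic `s` is kept by `s w` of the possible insertions into `w` and raised by one by
the others, this counts the results with statistic `k + 1`. -/
theorem card_insertions_succ (s : W → ℕ) (A : W → Q → Prop) [∀ w q, Decidable (A w q)]
    (hA : ∀ w, (Finset.univ.filter fun q => A w q).card = s w) (k : ℕ) :
    (Finset.univ.filter fun x : W × Q => s x.1 + (if A x.1 x.2 then 0 else 1) = k + 1).card =
      (k + 1) * (Finset.univ.filter fun w => s w = k + 1).card +
        (Fintype.card Q - k) * (Finset.univ.filter fun w => s w = k).card := by
  rw [card_filter_prod_eq_sum (fun w q => s w + (if A w q then 0 else 1) = k + 1),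
    Finset.card_filter, Finset.card_filter, Finset.mul_sum, Finset.mul_sum,
    ← Finset.sum_add_distrib]
  refine Finset.sum_congr rfl fun w _ => ?_
  have hsplit := Finset.card_filter_add_card_filter_not (s := (Finset.univ : Finset Q))
    (fun q => A w q)
  rw [hA, Finset.card_univ] at hsplit
  by_cases h1 : s w = k + 1
  · have : (Finset.univ.filter fun q => s w + (if A w q then 0 else 1) = k + 1) =
        Finset.univ.filter fun q => A w q := by
      ext q; by_cases hq : A w q <;> simp [hq, h1]
    rw [this, hA]
    simp [h1]
  · by_cases h2 : s w = k
    · have : (Finset.univ.filter fun q => s w + (if A w q then 0 else 1) = k + 1) =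
          Finset.univ.filter fun q => ¬ A w q := by
        ext q; by_cases hq : A w q <;> simp [hq, h2]
      rw [this]
      rw [if_neg h1, if_pos h2]
      omega
    · have : (Finset.univ.filter fun q => s w + (if A w q then 0 else 1) = k + 1) = ∅ := by
        ext q; by_cases hq : A w q <;> simp [hq, h1, h2]
      rw [this]
      simp [h1, h2]

/-- If `s w = 0`, no insertion keeps the statistic, so each one raises it. -/
theorem card_insertions_zero (s : W → ℕ) (A : W → Q → Prop) [∀ w q, Decidable (A w q)]
    (hA : ∀ w, (Finset.univ.filter fun q => A w q).card = s w) :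
    (Finset.univ.filter fun x : W × Q => s x.1 + (if A x.1 x.2 then 0 else 1) = 0).card = 0 := by
  rw [Finset.card_eq_zero, Finset.filter_eq_empty_iff]
  rintro ⟨w, q⟩ - h
  have h0 : s w = 0 := (Nat.add_eq_zero_iff.1 h).1
  rw [← hA, Finset.card_eq_zero, Finset.filter_eq_empty_iff] at h0
  simp [h0 (Finset.mem_univ q)] at h

end Counting

/-! ### Permutations with one prescribed value. -/

section InsertPerm

variable {n : ℕ}

/-- The permutation that sends `i` to `j` and is order isomorphic to `w` elsewhere. -/
def insertPerm (i j : Fin (n + 1)) (w : Equiv.Perm (Fin n)) : Equiv.Perm (Fin (n + 1)) :=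
  (finSuccEquiv' i).trans (w.optionCongr.trans (finSuccEquiv' j).symm)

@[simp] theorem insertPerm_self (i j : Fin (n + 1)) (w : Equiv.Perm (Fin n)) :
    insertPerm i j w i = j := by
  simp [insertPerm]

@[simp] theorem insertPerm_succAbove (i j : Fin (n + 1)) (w : Equiv.Perm (Fin n)) (x : Fin n) :
    insertPerm i j w (i.succAbove x) = j.succAbove (w x) := by
  simp [insertPerm]

@[simp] theorem insertPerm_last_castSucc (j : Fin (n + 1)) (w : Equiv.Perm (Fin n)) (x : Fin n) :
    insertPerm (Fin.last n) j w x.castSucc = j.succAbove (w x) := by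
  rw [← Fin.succAbove_last_apply, insertPerm_succAbove]

theorem insertPerm_injective (i j : Fin (n + 1)) : Function.Injective (insertPerm i j) := by
  intro v w h
  ext x
  have := congrArg (fun u : Equiv.Perm (Fin (n + 1)) => u (i.succAbove x)) h
  simp only [insertPerm_succAbove] at this
  rw [Fin.succAbove_right_injective this]

theorem exists_insertPerm_eq {i j : Fin (n + 1)} {u : Equiv.Perm (Fin (n + 1))} (h : u i = j) :
    ∃ w, insertPerm i j w = u := by
  -- Seen through `finSuccEquiv'` at `i` and at `j`, the condition `u i = j` says that `none` is
  -- fixed, so `none` can be removed.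
  let e : Option (Fin n) ≃ Option (Fin n) :=
    (finSuccEquiv' i).symm.trans (u.trans (finSuccEquiv' j))
  have he : e none = none := by simp [e, h]
  refine ⟨e.removeNone, Equiv.ext fun x => ?_⟩
  rcases Fin.eq_self_or_eq_succAbove i x with rfl | ⟨y, rfl⟩
  · rw [insertPerm_self, h]
  · rw [insertPerm_succAbove]
    have hy : e (some y) ≠ none := fun h' => by
      have := e.injective (h'.trans he.symm)
      simp at this
    have := Equiv.removeNone_some e (Option.ne_none_iff_exists'.1 hy)
    have h2 : (finSuccEquiv' j).symm (some (e.removeNone y)) = (finSuccEquiv' j).symm (e (some y)) := by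
      rw [this]
    simpa [e] using h2

end InsertPerm

/-! ### Descents and the Eulerian recurrence. -/

section Eulerian

theorem eulerianNumber_eq_card (d k : ℕ) :
    eulerianNumber d k =
      (Finset.univ.filter fun w : Equiv.Perm (Fin d) => descentCount w = k).card := by
  rw [eulerianNumber, Nat.card_eq_fintype_card, Fintype.card_subtype]

theorem descentCount_eq_sum {n : ℕ} (w : Equiv.Perm (Fin (n + 1))) :
    descentCount w = ∑ i : Fin n, if w i.succ < w i.castSucc then 1 else 0 := by
  rw [descentCount, Finset.card_filter, Fin.sum_univ_castSucc]
  rw [if_neg (by rintro ⟨h, -⟩; simp at h), add_zero]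
  refine Finset.sum_congr rfl fun i _ => if_congr ⟨?_, ?_⟩ rfl rfl
  · rintro ⟨_, h⟩; exact h
  · intro h; exact ⟨by simp, h⟩

/-- `q` is the second of the two positions of a descent of `w`. -/
def IsDescentBottom {n : ℕ} (w : Equiv.Perm (Fin (n + 1))) (q : Fin (n + 1)) : Prop :=
  ∃ j : Fin n, j.succ = q ∧ w j.succ < w j.castSucc

instance {n : ℕ} (w : Equiv.Perm (Fin (n + 1))) (q : Fin (n + 1)) :
    Decidable (IsDescentBottom w q) :=
  inferInstanceAs (Decidable (∃ j : Fin n, j.succ = q ∧ w j.succ < w j.castSucc))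

theorem isDescentBottom_succ {n : ℕ} {w : Equiv.Perm (Fin (n + 1))} {j : Fin n} :
    IsDescentBottom w j.succ ↔ w j.succ < w j.castSucc := by
  simp [IsDescentBottom]

theorem not_isDescentBottom_zero {n : ℕ} {w : Equiv.Perm (Fin (n + 1))} :
    ¬ IsDescentBottom w 0 := by
  simp [IsDescentBottom, Fin.succ_ne_zero]

theorem card_isDescentBottom {n : ℕ} (w : Equiv.Perm (Fin (n + 1))) :
    (Finset.univ.filter fun q => IsDescentBottom w q).card = descentCount w := by
  rw [descentCount_eq_sum, Finset.card_filter, Fin.sum_univ_succ,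
    if_neg not_isDescentBottom_zero, zero_add]
  simp only [isDescentBottom_succ]

theorem descentCount_insertPerm_last {n : ℕ} (w : Equiv.Perm (Fin (n + 1))) :
    descentCount (insertPerm (Fin.last (n + 1)) (Fin.last (n + 1)) w) = descentCount w := by
  rw [descentCount_eq_sum, descentCount_eq_sum, Fin.sum_univ_castSucc, Fin.succ_last,
    insertPerm_self, if_neg (Fin.le_last _).not_gt, add_zero]
  refine Finset.sum_congr rfl fun i _ => ?_
  rw [← Fin.castSucc_succ, insertPerm_last_castSucc, insertPerm_last_castSucc]
  simp

theorem descentCount_insertPerm_castSucc {n : ℕ} (w : Equiv.Perm (Fin (n + 1)))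
    (q : Fin (n + 1)) :
    descentCount (insertPerm q.castSucc (Fin.last (n + 1)) w) =
      descentCount w + if IsDescentBottom w q then 0 else 1 := by
  -- The adjacent pairs of the new word, other than the maximum and its successor, correspond to
  -- those of `w`. The pair ending at `q` now ends at the maximum, so it is no longer a descent; the
  -- others are unchanged.
  have key : ∀ j : Fin n,
      (insertPerm q.castSucc (Fin.last (n + 1)) w (q.succAbove j).succ <
        insertPerm q.castSucc (Fin.last (n + 1)) w (q.succAbove j).castSucc) ↔
      w j.succ < w j.castSucc ∧ j.succ ≠ q := by
    intro j
    rcases lt_or_ge j.castSucc q with hj | hj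
    · rw [Fin.succAbove_of_castSucc_lt _ _ hj, Fin.succ_castSucc]
      have h1 : insertPerm q.castSucc (Fin.last (n + 1)) w j.castSucc.castSucc =
          (w j.castSucc).castSucc := by
        rw [← Fin.succAbove_of_castSucc_lt q.castSucc j.castSucc (by simpa using hj),
          insertPerm_succAbove, Fin.succAbove_last_apply]
      rw [h1]
      rcases eq_or_ne j.succ q with rfl | hne
      · rw [insertPerm_self]
        simp [(Fin.le_last _).not_gt]
      · have hlt : j.succ < q := lt_of_le_of_ne (Fin.castSucc_lt_iff_succ_le.1 hj) hne
        rw [← Fin.succAbove_of_castSucc_lt q.castSucc j.succ (Fin.castSucc_lt_castSucc_iff.2 hlt),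
          insertPerm_succAbove, Fin.succAbove_last_apply]
        simp [hne]
    · rw [Fin.succAbove_of_le_castSucc _ _ hj, ← Fin.succ_castSucc,
        ← Fin.succAbove_of_le_castSucc q.castSucc j.castSucc (by simpa using hj),
        ← Fin.succAbove_of_le_castSucc q.castSucc j.succ
          (Fin.castSucc_le_castSucc_iff.2 (hj.trans Fin.castSucc_lt_succ.le)),
        insertPerm_succAbove, insertPerm_succAbove]
      have hne : j.succ ≠ q := (hj.trans_lt (Fin.castSucc_lt_succ)).ne'
      simp [hne]
  -- The maximum and its successor always form a descent, which makes up for the one destroyed when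
  -- `q` is a descent bottom and is a gain otherwise.
  have hq : insertPerm q.castSucc (Fin.last (n + 1)) w q.succ <
      insertPerm q.castSucc (Fin.last (n + 1)) w q.castSucc := by
    rw [← Fin.succAbove_castSucc_self, insertPerm_succAbove, insertPerm_self,
      Fin.succAbove_last_apply]
    exact Fin.castSucc_lt_last _
  rw [descentCount_eq_sum, descentCount_eq_sum, Fin.sum_univ_succAbove _ q, if_pos hq]
  simp only [key]
  cases q using Fin.cases with
  | zero =>
    rw [if_neg not_isDescentBottom_zero, add_comm]
    simp [Fin.succ_ne_zero]
  | succ i =>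
    simp only [isDescentBottom_succ, ne_eq, Fin.succ_inj]
    rw [← Finset.add_sum_erase _ _ (Finset.mem_univ i), ← Finset.add_sum_erase _ _ (Finset.mem_univ i)]
    have : ∀ j ∈ Finset.univ.erase i,
        (if w j.succ < w j.castSucc ∧ ¬ j = i then 1 else 0) =
          if w j.succ < w j.castSucc then 1 else 0 := fun j hj => by
      simp [Finset.ne_of_mem_erase hj]
    rw [Finset.sum_congr rfl this]
    split_ifs <;> simp_all; omega

theorem insertPerm_prod_bijective {n : ℕ} (j : Fin (n + 1)) :
    Function.Bijective fun x : Fin (n + 1) × Equiv.Perm (Fin n) => insertPerm x.1 j x.2 := by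
  refine ⟨?_, fun u => ?_⟩
  · rintro ⟨i, v⟩ ⟨i', v'⟩ h
    obtain rfl : i = i' := (insertPerm i j v).injective <| by
      rw [insertPerm_self]
      exact ((congrArg (fun u : Equiv.Perm (Fin (n + 1)) => u i') h).trans
        (insertPerm_self i' j v')).symm
    exact Prod.ext rfl (insertPerm_injective i j h)
  · obtain ⟨w, hw⟩ := exists_insertPerm_eq (u.apply_symm_apply j)
    exact ⟨(u.symm j, w), hw⟩

theorem eulerianNumber_add_two (n k : ℕ) :
    eulerianNumber (n + 2) k =
      eulerianNumber (n + 1) k +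
        (Finset.univ.filter fun x : Equiv.Perm (Fin (n + 1)) × Fin (n + 1) =>
          descentCount x.1 + (if IsDescentBottom x.1 x.2 then 0 else 1) = k).card := by
  -- Classify by the position of the largest value; the last position is split off because it never
  -- changes the number of descents.
  rw [eulerianNumber_eq_card, eulerianNumber_eq_card, Finset.card_filter,
    ← (insertPerm_prod_bijective (Fin.last (n + 1))).sum_comp, Fintype.sum_prod_type,
    Fin.sum_univ_castSucc, add_comm]
  congr 1
  · simp only [descentCount_insertPerm_last, Finset.card_filter]
  · rw [Finset.sum_comm, Finset.card_filter, Fintype.sum_prod_type]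
    simp only [descentCount_insertPerm_castSucc]

theorem eulerianNumber_add_two_zero (n : ℕ) :
    eulerianNumber (n + 2) 0 = eulerianNumber (n + 1) 0 := by
  rw [eulerianNumber_add_two, card_insertions_zero _ _ card_isDescentBottom, add_zero]

theorem eulerianNumber_add_two_succ (n k : ℕ) :
    eulerianNumber (n + 2) (k + 1) =
      (k + 2) * eulerianNumber (n + 1) (k + 1) + (n + 1 - k) * eulerianNumber (n + 1) k := by
  rw [eulerianNumber_add_two, card_insertions_succ _ _ card_isDescentBottom, Fintype.card_fin,
    ← eulerianNumber_eq_card, ← eulerianNumber_eq_card]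
  ring

theorem eulerianNumber_one (k : ℕ) : eulerianNumber 1 k = if k = 0 then 1 else 0 := by
  rw [eulerianNumber_eq_card]
  have : ∀ w : Equiv.Perm (Fin 1), descentCount w = 0 := fun w => by
    rw [descentCount_eq_sum]
    rfl
  simp only [this]
  split_ifs with h
  · simp [h]
  · simp [Ne.symm h]

theorem isBalancedFacePair_eulerianNumber (n : ℕ) :
    ∃ g, IsBalancedFacePair (eulerianNumber (n + 1)) g n := by
  induction n with
  | zero =>
    exact ⟨fun _ => 0, isBalancedFacePair_base (by simp [eulerianNumber_one])
      (by simp [eulerianNumber_one]) (fun _ => rfl)⟩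
  | succ n ih =>
    obtain ⟨g, hg⟩ := ih
    exact ⟨_, hg.step 0 (eulerianNumber_add_two_zero n)
      (fun k => by rw [eulerianNumber_add_two_succ]; ring)⟩

end Eulerian

/-! ### Exceedances and the derangement recurrence. -/

section Derangements

variable {n : ℕ}

/-- The permutation of `Fin (n + 1)` whose cycles are those of `w`, with `Fin.last n` inserted
after `j`. -/
def insertAfter (j : Fin n) (w : Equiv.Perm (Fin n)) : Equiv.Perm (Fin (n + 1)) :=
  insertPerm (Fin.last n) (Fin.last n) w * Equiv.swap j.castSucc (Fin.last n)

theorem insertAfter_last (j : Fin n) (w : Equiv.Perm (Fin n)) :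
    insertAfter j w (Fin.last n) = (w j).castSucc := by
  simp [insertAfter]

theorem insertAfter_castSucc (j : Fin n) (w : Equiv.Perm (Fin n)) (x : Fin n) :
    insertAfter j w x.castSucc = if x = j then Fin.last n else (w x).castSucc := by
  split_ifs with h
  · simp [insertAfter, h]
  · rw [insertAfter, Equiv.Perm.mul_apply, Equiv.swap_apply_of_ne_of_ne]
    · simp
    · simpa using h
    · exact (Fin.castSucc_lt_last x).ne

theorem insertAfter_prod_injective :
    Function.Injective fun x : Equiv.Perm (Fin n) × Fin n => insertAfter x.2 x.1 := by
  rintro ⟨v, j⟩ ⟨w, i⟩ h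
  have h1 := congrArg (fun u : Equiv.Perm (Fin (n + 1)) => u j.castSucc) h
  simp only [insertAfter_castSucc, if_true] at h1
  have hji : j = i := by
    by_contra hne
    rw [if_neg hne] at h1
    exact (Fin.castSucc_lt_last _).ne' h1
  subst hji
  exact Prod.ext (insertPerm_injective _ _ (mul_right_cancel h)) rfl

theorem exists_insertAfter_eq {u : Equiv.Perm (Fin (n + 1))} (hu : u (Fin.last n) ≠ Fin.last n) :
    ∃ w j, insertAfter j w = u := by
  obtain ⟨j, hj⟩ : ∃ j : Fin n, j.castSucc = u.symm (Fin.last n) :=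
    ⟨_, Fin.castSucc_castPred _ fun h => hu (by rw [← h, Equiv.apply_symm_apply, h])⟩
  obtain ⟨w, hw⟩ := exists_insertPerm_eq (i := Fin.last n) (j := Fin.last n)
    (u := u * Equiv.swap j.castSucc (Fin.last n)) (by simp [hj])
  exact ⟨w, j, by rw [insertAfter, hw, mul_assoc, Equiv.swap_mul_self, mul_one]⟩

theorem insertAfter_mem_derangements {j : Fin n} {w : Equiv.Perm (Fin n)} :
    insertAfter j w ∈ derangements (Fin (n + 1)) ↔ ∀ x, w x = x → x = j := by
  constructor
  · intro h x hx
    by_contra hne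
    apply h x.castSucc
    rw [insertAfter_castSucc, if_neg hne, hx]
  · intro h x
    cases x using Fin.lastCases with
    | last => rw [insertAfter_last]; exact (Fin.castSucc_lt_last _).ne
    | cast x =>
      rw [insertAfter_castSucc]
      split_ifs with hx
      · exact (Fin.castSucc_lt_last _).ne'
      · exact fun h' => hx (h x (Fin.castSucc_injective _ h'))

/-- Only `j` changes status among the old points: it now maps to the maximum and is an exceedance.
The maximum itself never is one. -/
theorem exceedanceCount_insertAfter (j : Fin n) (w : Equiv.Perm (Fin n)) :
    exceedanceCount (insertAfter j w) = exceedanceCount w + if j < w j then 0 else 1 := by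
  rw [exceedanceCount, exceedanceCount, Finset.card_filter, Finset.card_filter,
    Fin.sum_univ_castSucc, if_neg (Fin.le_last _).not_gt, add_zero,
    ← Finset.add_sum_erase _ _ (Finset.mem_univ j),
    ← Finset.add_sum_erase _ (fun i => if i < w i then 1 else 0) (Finset.mem_univ j),
    insertAfter_castSucc, if_pos rfl, if_pos (Fin.castSucc_lt_last j)]
  have : ∀ x ∈ Finset.univ.erase j,
      (if x.castSucc < insertAfter j w x.castSucc then 1 else 0) =
        if x < w x then 1 else 0 := fun x hx => by
    rw [insertAfter_castSucc, if_neg (Finset.ne_of_mem_erase hx)]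
    simp
  rw [Finset.sum_congr rfl this]
  split_ifs <;> omega

theorem exceedanceCount_insertPerm (i : Fin (n + 1)) (w : Equiv.Perm (Fin n)) :
    exceedanceCount (insertPerm i i w) = exceedanceCount w := by
  rw [exceedanceCount, exceedanceCount, Finset.card_filter, Finset.card_filter,
    Fin.sum_univ_succAbove _ i, insertPerm_self, if_neg (lt_irrefl i), zero_add]
  simp

theorem exceedanceCount_pos {w : Equiv.Perm (Fin (n + 1))}
    (hw : w ∈ derangements (Fin (n + 1))) : 0 < exceedanceCount w :=
  Finset.card_pos.2 ⟨0, Finset.mem_filter.2 ⟨Finset.mem_univ _, Fin.pos_iff_ne_zero.2 (hw 0)⟩⟩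

/-- The number of derangements of `Fin n` with `k` exceedances. -/
noncomputable def derangementExceedances (n k : ℕ) : ℕ :=
  Nat.card {w : Equiv.Perm (Fin n) // w ∈ derangements (Fin n) ∧ exceedanceCount w = k}

theorem derangementExceedances_zero (n : ℕ) : derangementExceedances (n + 1) 0 = 0 := by
  have : IsEmpty {w : Equiv.Perm (Fin (n + 1)) //
      w ∈ derangements (Fin (n + 1)) ∧ exceedanceCount w = 0} :=
    ⟨fun w => (exceedanceCount_pos w.2.1).ne' w.2.2⟩
  exact Nat.card_of_isEmpty

open Classical in
theorem derangementExceedances_eq_card (n k : ℕ) :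
    derangementExceedances n k =
      (Finset.univ.filter fun w : derangements (Fin n) => exceedanceCount w.1 = k).card := by
  rw [derangementExceedances, ← Fintype.card_subtype, ← Nat.card_eq_fintype_card]
  exact Nat.card_congr (Equiv.subtypeSubtypeEquivSubtypeInter _ _).symm

-- Remove the maximum from its cycle, remembering its predecessor `j`. Either a derangement remains,
-- or `j` is its only fixed point; deleting `j` as well then leaves a derangement of `n` points,
-- with `n + 1` choices of `j` and one exceedance fewer.
open Classical in
theorem derangementExceedances_add_two (n k : ℕ) :
    derangementExceedances (n + 2) (k + 1) =
      (Finset.univ.filter fun x : derangements (Fin (n + 1)) × Fin (n + 1) =>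
        exceedanceCount x.1.1 + (if x.2 < x.1.1 x.2 then 0 else 1) = k + 1).card +
      (n + 1) * derangementExceedances n k := by
  have h1 : derangementExceedances (n + 2) (k + 1) =
      (Finset.univ.filter fun x : Equiv.Perm (Fin (n + 1)) × Fin (n + 1) =>
        (∀ y, x.1 y = y → y = x.2) ∧
          exceedanceCount x.1 + (if x.2 < x.1 x.2 then 0 else 1) = k + 1).card := by
    rw [derangementExceedances, Nat.card_eq_fintype_card, Fintype.card_subtype]
    symm
    refine Finset.card_nbij (fun x => insertAfter x.2 x.1) ?_
      insertAfter_prod_injective.injOn ?_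
    · intro x hx
      simpa [insertAfter_mem_derangements, exceedanceCount_insertAfter] using hx
    · intro u hu
      simp only [Finset.coe_filter, Finset.mem_univ, true_and, Set.mem_ofPred_eq] at hu
      obtain ⟨w, j, rfl⟩ := exists_insertAfter_eq (hu.1 (Fin.last _))
      rw [insertAfter_mem_derangements, exceedanceCount_insertAfter] at hu
      exact ⟨(w, j), by simpa using hu, rfl⟩
  rw [h1, ← Finset.card_filter_add_card_filter_not (fun x => x.1 x.2 ≠ x.2)]
  congr 1
  · symm
    refine Finset.card_nbij (fun x => (x.1.1, x.2)) ?_ ?_ ?_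
    · rintro ⟨⟨w, hw⟩, j⟩ hx
      simp only [Finset.coe_filter, Finset.mem_filter, Finset.mem_univ, true_and,
        Set.mem_ofPred_eq] at hx ⊢
      exact ⟨⟨fun y hy => absurd hy (hw y), hx⟩, hw j⟩
    · rintro ⟨⟨w, hw⟩, j⟩ - ⟨⟨w', hw'⟩, j'⟩ - h
      simpa using h
    · rintro ⟨w, j⟩ hx
      simp only [Finset.coe_filter, Finset.mem_filter, Finset.mem_univ, true_and,
        Set.mem_ofPred_eq] at hx
      exact ⟨(⟨w, fun y hy => hx.2 (hx.1.1 y hy ▸ hy)⟩, j), by simpa using hx.1.2, rfl⟩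
  · have h2 : (n + 1) * derangementExceedances n k =
        (Finset.univ.filter fun x : derangements (Fin n) × Fin (n + 1) =>
          exceedanceCount x.1.1 = k).card := by
      have : (Finset.univ.filter fun x : derangements (Fin n) × Fin (n + 1) =>
          exceedanceCount x.1.1 = k) =
          (Finset.univ.filter fun w : derangements (Fin n) => exceedanceCount w.1 = k) ×ˢ
            Finset.univ := by
        ext; simp
      rw [derangementExceedances_eq_card, this, Finset.card_product, Finset.card_univ,
        Fintype.card_fin, mul_comm]
    rw [h2]
    symm
    refine Finset.card_nbij (fun x => (insertPerm x.2 x.2 x.1.1, x.2)) ?_ ?_ ?_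
    · rintro ⟨⟨w, hw⟩, j⟩ hx
      simp only [Finset.coe_filter, Finset.mem_filter, Finset.mem_univ, true_and,
        Set.mem_ofPred_eq] at hx ⊢
      refine ⟨⟨fun y hy => ?_, ?_⟩, by simp⟩
      · rcases Fin.eq_self_or_eq_succAbove j y with h | ⟨z, rfl⟩
        · exact h
        · rw [insertPerm_succAbove] at hy
          exact absurd (Fin.succAbove_right_injective hy) (hw z)
      · rw [exceedanceCount_insertPerm, insertPerm_self, if_neg (lt_irrefl j), hx]
    · rintro ⟨⟨w, hw⟩, j⟩ - ⟨⟨w', hw'⟩, j'⟩ - h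
      simp only [Prod.mk.injEq] at h
      obtain ⟨h, rfl⟩ := h
      obtain rfl := insertPerm_injective _ _ h
      rfl
    · rintro ⟨u, j⟩ hx
      simp only [Finset.coe_filter, Finset.mem_filter, Finset.mem_univ, true_and,
        Set.mem_ofPred_eq, not_not] at hx
      obtain ⟨⟨hfix, hexc⟩, hj⟩ := hx
      obtain ⟨w, rfl⟩ := exists_insertPerm_eq hj
      rw [exceedanceCount_insertPerm, insertPerm_self, if_neg (lt_irrefl j)] at hexc
      refine ⟨(⟨w, fun y hy => ?_⟩, j), by simpa using hexc, rfl⟩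
      exact Fin.succAbove_ne j y (hfix _ (by rw [insertPerm_succAbove, hy]))

theorem derangementExceedances_add_two_succ (n k : ℕ) :
    derangementExceedances (n + 2) (k + 1) =
      (k + 1) * derangementExceedances (n + 1) (k + 1) +
        (n + 1 - k) * derangementExceedances (n + 1) k +
        (n + 1) * derangementExceedances n k := by
  classical
  rw [derangementExceedances_add_two,
    card_insertions_succ (fun w : derangements (Fin (n + 1)) => exceedanceCount w.1)
      (fun w j => j < w.1 j) (fun w => rfl), Fintype.card_fin,
    ← derangementExceedances_eq_card, ← derangementExceedances_eq_card]

theorem derangementNumber_eq_derangementExceedances (d k : ℕ) :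
    derangementNumber d k = derangementExceedances (d + 1) (k + 1) := rfl

theorem derangementNumber_zero (k : ℕ) : derangementNumber 0 k = 0 := by
  have : IsEmpty {w : Equiv.Perm (Fin (0 + 1)) //
      w ∈ derangements (Fin (0 + 1)) ∧ exceedanceCount w = k + 1} :=
    ⟨fun w => w.2.1 0 (Subsingleton.elim (α := Fin 1) _ _)⟩
  exact Nat.card_of_isEmpty

theorem derangementExceedances_zero_left (k : ℕ) :
    derangementExceedances 0 k = if k = 0 then 1 else 0 := by
  have hexc : ∀ w : Equiv.Perm (Fin 0), exceedanceCount w = 0 := fun w => rfl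
  split_ifs with h
  · refine Nat.card_eq_one_iff_unique.2 ⟨inferInstance, ⟨1, fun x => x.elim0, ?_⟩⟩
    rw [hexc, h]
  · have : IsEmpty {w : Equiv.Perm (Fin 0) // w ∈ derangements (Fin 0) ∧ exceedanceCount w = k} :=
      ⟨fun w => h (w.2.2.symm.trans (hexc _))⟩
    exact Nat.card_of_isEmpty

theorem derangementNumber_one (k : ℕ) : derangementNumber 1 k = if k = 0 then 1 else 0 := by
  have hone : ∀ k, derangementExceedances 1 k = 0 := by
    rintro (_ | k)
    · exact derangementExceedances_zero 0
    · exact derangementNumber_zero k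
  -- There are no derangements of one point, so only the empty permutation contributes, through the
  -- last term.
  have h := derangementExceedances_add_two_succ 0 k
  simpa [derangementNumber_eq_derangementExceedances, hone, derangementExceedances_zero_left] using h

theorem isBalancedFacePair_derangementNumber (n : ℕ) :
    IsBalancedFacePair (derangementNumber (n + 1)) (derangementNumber n) n := by
  induction n with
  | zero =>
    exact isBalancedFacePair_base (by simp [derangementNumber_one])
      (by simp [derangementNumber_one]) derangementNumber_zero
  | succ n ih =>
    -- Row `n + 2` concerns derangements of `n + 3` points, for which the last coefficient of the
    -- recurrence is `n + 2`.
    refine ih.step (n + 2) ?_ fun k => ?_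
    · simp only [derangementNumber_eq_derangementExceedances]
      have h := derangementExceedances_add_two_succ (n + 1) 0
      simpa only [derangementExceedances_zero, mul_zero, add_zero, zero_add, one_mul] using h
    · simp only [derangementNumber_eq_derangementExceedances]
      have h := derangementExceedances_add_two_succ (n + 1) (k + 1)
      simpa only [Nat.add_sub_add_right] using h

end Derangements

theorem mainTheorem4 (d : ℕ) (hd : 1 ≤ d) :
    IsFPolynomial (eulerianPolynomial d) ∧
    IsFPolynomial (stirlingPolynomial d) ∧
    IsFPolynomial (derangementPolynomial d) := by
  obtain ⟨n, rfl⟩ := Nat.exists_eq_add_of_le' hd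
  obtain ⟨g, hg⟩ := isBalancedFacePair_eulerianNumber n
  exact ⟨hg.isFPolynomial, isFPolynomial_stirlingPolynomial n,
    (isBalancedFacePair_derangementNumber n).isFPolynomial⟩
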